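/- Work on $(0,\infty)$ with Lebesgue measure $|\cdot|$. For a measurable $f$ let $f^*(t)=\inf\{\lambda\ge 0: |\{|f|>\lambda\}|\le t\}$, $t\ge 0$, be its decreasing rearrangement. A function $\varphi:(0,\infty)\to(0,\infty)$ is quasi-concave if it is (weakly) increasing and $\varphi(t)/t$ is (weakly) decreasing; put $\varphi(0)=0$ and $$\Lambda_\varphi=\Big\{f:\ \|f\|_{\Lambda_\varphi}=\int_{[0,\infty)} f^*\,d\varphi<\infty\Big\},$$ where $d\varphi$ is the Lebesgue–Stieltjes measure (with mass $\varphi(0+)$ at $0$). An r.i. Banach space is a rearrangement invariant Banach function space on $(0,\infty)$ in the sense of Bennett and Sharpley (in particular with the Fatou property). If $X$ is an r.i. Banach space containing the function $s\mapsto 1/(1+s)$, then $W_X(t)=\big\|\frac{1}{1+\cdot/t}\big\|_X$ is quasi-concave, and one sets $R(X)=\Lambda_{W_X}$. Let $Sf(t)=\frac1t\int_0^t f(r)\,dr$ be the Hardy operator, and let $\mathfrak{R}[S,\Lambda_\varphi]$ denote the minimal r.i. Banach space $Y$ such that $S:\Lambda_\varphi\to Y$ is bounded, that is, $S:\Lambda_\varphi\to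 Y$ is bounded and $Y\subset Z$ for every r.i. Banach space $Z$ such that $S:\Lambda_\varphi\to Z$ is bounded. Let $\varphi$ be a quasi-concave function for which there is a constant $C>0$ with $\varphi(t)\ge C\,t\log(1+1/t)$ for all $t>0$. Then $\mathfrak{R}[S,\Lambda_\varphi]$ exists, and if there is an r.i. Banach space $X$ (containing $1/(1+s)$) with $R(X)=\Lambda_\varphi$, then $\mathfrak{R}[S,\Lambda_\varphi]$ contains $1/(1+s)$ and $R(\mathfrak{R}[S,\Lambda_\varphi])=\Lambda_\varphi$. Consequently, the equation $R(X)=\Lambda_\varphi$ has a solution $X$ among the r.i. Banach spaces if and only if $X=\mathfrak{R}[S,\Lambda_\varphi]$ is a solution. -/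

import Mathlib

open MeasureTheory Set
open scoped ENNReal NNReal

noncomputable section

namespace RestrictedType

/-- Lebesgue measure on the half-line `(0, ∞)`. Functions on `(0, ∞)` are represented by functions
on `ℝ`, whose values outside `(0, ∞)` play no role. -/
def halfLine : Measure ℝ := volume.restrict (Ioi 0)

/-- The distribution function `λ ↦ |{x > 0 : f x > λ}|` of a nonnegative function. -/
def distribution (f : ℝ → ℝ≥0∞) (l : ℝ≥0∞) : ℝ≥0∞ := halfLine {x | l < f x}

/-- The decreasing rearrangement `f^*(t) = inf {λ ≥ 0 : |{|f| > λ}| ≤ t}` for `t ≥ 0`;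
in particular `f^*(0)` is the essential supremum of `|f|`. -/
def rearrangement (f : ℝ → ℝ) (t : ℝ) : ℝ≥0∞ :=
  sInf {l : ℝ≥0∞ | distribution (fun x => ‖f x‖ₑ) l ≤ ENNReal.ofReal t}

/-- Quasi-concave functions on `(0, ∞)` (only the values at `t > 0` matter). -/
structure QuasiConcave (φ : ℝ → ℝ) : Prop where
  pos : ∀ t, 0 < t → 0 < φ t
  mono : ∀ s t, 0 < s → s ≤ t → φ s ≤ φ t
  div_anti : ∀ s t, 0 < s → s ≤ t → φ t / t ≤ φ s / s

theorem QuasiConcave.monotone_extend {φ : ℝ → ℝ} (hφ : QuasiConcave φ) :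
    Monotone (fun t : ℝ => if t ≤ 0 then 0 else φ t) := by
  intro s t hst
  dsimp only
  split_ifs with hs ht ht
  · exact le_rfl
  · exact (hφ.pos t (not_le.mp ht)).le
  · exact absurd (hst.trans ht) hs
  · exact hφ.mono s t (not_le.mp hs) hst

/-- The Lebesgue–Stieltjes measure `dφ` on `[0, ∞)`, where `φ` is normalized by `φ(0) = 0`;
it has an atom of mass `φ(0+)` at `0`. -/
def QuasiConcave.measure {φ : ℝ → ℝ} (hφ : QuasiConcave φ) : Measure ℝ :=
  hφ.monotone_extend.stieltjesFunction.measure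

/-- `‖f‖_{Λ_φ} = ∫_{[0,∞)} f^* dφ`. -/
def lorentzNorm {φ : ℝ → ℝ} (hφ : QuasiConcave φ) (f : ℝ → ℝ) : ℝ≥0∞ :=
  ∫⁻ t, rearrangement f t ∂hφ.measure

/-- The minimal Lorentz space `Λ_φ`. -/
def lorentzSpace {φ : ℝ → ℝ} (hφ : QuasiConcave φ) : Set (ℝ → ℝ) :=
  {f | AEMeasurable f halfLine ∧ lorentzNorm hφ f < ∞}

/-- A rearrangement invariant Banach function space on `(0, ∞)`, given by its function norm `ρ`
on nonnegative measurable functions (in the sense of Bennett and Sharpley). -/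
structure RISpace where
  ρ : (ℝ → ℝ≥0∞) → ℝ≥0∞
  eq_zero_iff : ∀ f, AEMeasurable f halfLine → (ρ f = 0 ↔ f =ᵐ[halfLine] 0)
  smul : ∀ (a : ℝ≥0) (f), AEMeasurable f halfLine → ρ (fun x => (a : ℝ≥0∞) * f x) = a * ρ f
  add_le : ∀ f g, AEMeasurable f halfLine → AEMeasurable g halfLine →
    ρ (fun x => f x + g x) ≤ ρ f + ρ g
  mono : ∀ f g, AEMeasurable f halfLine → AEMeasurable g halfLine →
    (∀ᵐ x ∂halfLine, f x ≤ g x) → ρ f ≤ ρ g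
  fatou : ∀ f : ℕ → ℝ → ℝ≥0∞, (∀ n, AEMeasurable (f n) halfLine) →
    (∀ᵐ x ∂halfLine, Monotone (fun n => f n x)) → ρ (fun x => ⨆ n, f n x) = ⨆ n, ρ (f n)
  indicator_lt_top : ∀ E : Set ℝ, MeasurableSet E → halfLine E < ∞ →
    ρ (E.indicator (fun _ => 1)) < ∞
  setLIntegral_le : ∀ E : Set ℝ, MeasurableSet E → halfLine E < ∞ →
    ∃ C : ℝ≥0, ∀ f, AEMeasurable f halfLine → ∫⁻ x in E, f x ∂halfLine ≤ C * ρ f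
  rearrangement_invariant : ∀ f g, AEMeasurable f halfLine → AEMeasurable g halfLine →
    (∀ l, distribution f l = distribution g l) → ρ f = ρ g

namespace RISpace

/-- `‖f‖_X = ρ(|f|)`. -/
def norm (X : RISpace) (f : ℝ → ℝ) : ℝ≥0∞ := X.ρ (fun x => ‖f x‖ₑ)

/-- The elements of the space `X`. -/
def carrier (X : RISpace) : Set (ℝ → ℝ) := {f | AEMeasurable f halfLine ∧ X.norm f < ∞}

/-- `W_X(t) = ‖1 / (1 + · / t)‖_X`. -/
def W (X : RISpace) (t : ℝ) : ℝ := (X.norm (fun s => 1 / (1 + s / t))).toReal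

theorem measurable_kernel (t : ℝ) : Measurable (fun s : ℝ => 1 / (1 + s / t)) := by fun_prop

theorem norm_le_mul (X : RISpace) {f g : ℝ → ℝ} (hf : Measurable f) (hg : Measurable g) (a : ℝ≥0)
    (h : ∀ x, 0 < x → |f x| ≤ a * |g x|) : X.norm f ≤ a * X.norm g := by
  have hg' : AEMeasurable (fun x => ‖g x‖ₑ) halfLine := hg.enorm.aemeasurable
  rw [norm, norm, ← X.smul a _ hg']
  refine X.mono _ _ hf.enorm.aemeasurable (hg'.const_mul _) ?_
  refine (ae_restrict_iff' measurableSet_Ioi).2 (Filter.Eventually.of_forall fun x hx => ?_)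
  have := h x hx
  rw [← ofReal_norm, ← ofReal_norm, ← ENNReal.ofReal_coe_nnreal,
    ← ENNReal.ofReal_mul a.coe_nonneg]
  exact ENNReal.ofReal_le_ofReal this

theorem norm_kernel_lt_top (X : RISpace) (hX : (fun s : ℝ => 1 / (1 + s)) ∈ X.carrier) {t : ℝ}
    (ht : 0 < t) : X.norm (fun s => 1 / (1 + s / t)) < ∞ := by
  refine (X.norm_le_mul (measurable_kernel t) (g := fun s => 1 / (1 + s)) (by fun_prop)
    (Real.toNNReal (max 1 t)) fun s hs => ?_).trans_lt (ENNReal.mul_lt_top (by simp) hX.2)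
  rw [Real.coe_toNNReal _ (by positivity), abs_of_pos (by positivity), abs_of_pos (by positivity),
    mul_one_div, div_le_div_iff₀ (by positivity) (by positivity)]
  have h1 : (1 : ℝ) ≤ max 1 t := le_max_left _ _
  have h2 : s ≤ max 1 t * (s / t) := by
    calc s = t * (s / t) := by field_simp
      _ ≤ _ := by gcongr; exact le_max_right _ _
  nlinarith

theorem norm_kernel_pos (X : RISpace) {t : ℝ} (ht : 0 < t) :
    0 < X.norm (fun s => 1 / (1 + s / t)) := by
  rw [pos_iff_ne_zero, norm, Ne, X.eq_zero_iff _ (measurable_kernel t).enorm.aemeasurable]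
  intro h
  have h' : ∀ᵐ x ∂halfLine, False := by
    have hmem : ∀ᵐ x ∂halfLine, x ∈ Ioi (0 : ℝ) := ae_restrict_mem measurableSet_Ioi
    filter_upwards [h, hmem] with x hx hx0
    have hx0' : (0 : ℝ) < x := hx0
    have : (0 : ℝ) < 1 / (1 + x / t) := by positivity
    simp only [Pi.zero_apply, enorm_eq_zero] at hx
    exact this.ne' hx
  have h0 : halfLine univ = 0 := by simpa [ae_iff] using h'
  simp [halfLine] at h0

theorem quasiConcave_W (X : RISpace) (hX : (fun s : ℝ => 1 / (1 + s)) ∈ X.carrier) :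
    QuasiConcave X.W where
  pos t ht := ENNReal.toReal_pos (X.norm_kernel_pos ht).ne' (X.norm_kernel_lt_top hX ht).ne
  mono s t hs hst := by
    have ht := hs.trans_le hst
    refine ENNReal.toReal_mono (X.norm_kernel_lt_top hX ht).ne ?_
    have := X.norm_le_mul (measurable_kernel s) (measurable_kernel t) 1 fun x hx => by
      rw [abs_of_pos (by positivity), abs_of_pos (by positivity), NNReal.coe_one, one_mul]
      gcongr
    simpa using this
  div_anti s t hs hst := by
    have ht := hs.trans_le hst
    have h := X.norm_le_mul (measurable_kernel t) (measurable_kernel s) (Real.toNNReal (t / s))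
      fun x hx => by
        rw [abs_of_pos (by positivity), abs_of_pos (by positivity),
          Real.coe_toNNReal _ (by positivity), mul_one_div,
          div_le_div_iff₀ (by positivity) (by positivity)]
        have h1 : (1 : ℝ) ≤ t / s := (one_le_div hs).2 hst
        have h2 : t / s * (x / t) = x / s := by field_simp
        nlinarith
    have h' := ENNReal.toReal_mono
      (ENNReal.mul_ne_top (by simp) (X.norm_kernel_lt_top hX hs).ne) h
    rw [ENNReal.toReal_mul, ENNReal.coe_toReal, Real.coe_toNNReal _ (by positivity)] at h'
    change X.W t ≤ t / s * X.W s at h'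
    rw [div_le_iff₀ ht]
    calc X.W t ≤ t / s * X.W s := h'
      _ = X.W s / s * t := by ring

/-- The space `R(X) = Λ_{W_X}`, defined when `1 / (1 + s)` belongs to `X`. -/
def R (X : RISpace) (hX : (fun s : ℝ => 1 / (1 + s)) ∈ X.carrier) : Set (ℝ → ℝ) :=
  lorentzSpace (X.quasiConcave_W hX)

/-- `X` solves the equation `R(X) = Λ_φ`: the space `R(X)` is defined and has the same elements
as `Λ_φ`. -/
def Solves (X : RISpace) {φ : ℝ → ℝ} (hφ : QuasiConcave φ) : Prop :=
  ∃ hX : (fun s : ℝ => 1 / (1 + s)) ∈ X.carrier, X.R hX = lorentzSpace hφ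

end RISpace

/-- The Hardy operator `S f (t) = (1 / t) ∫_0^t f(r) dr`. -/
def hardy (f : ℝ → ℝ) (t : ℝ) : ℝ := 1 / t * ∫ r in Ioc 0 t, f r

/-- `S : Λ_φ → Y` is bounded. -/
def HardyBounded {φ : ℝ → ℝ} (hφ : QuasiConcave φ) (Y : RISpace) : Prop :=
  ∃ C : ℝ≥0, ∀ f ∈ lorentzSpace hφ, hardy f ∈ Y.carrier ∧ Y.norm (hardy f) ≤ C * lorentzNorm hφ f

/-- `Y` is the minimal r.i. Banach function space such that `S : Λ_φ → Y` is bounded. -/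
def IsOptimalRange {φ : ℝ → ℝ} (hφ : QuasiConcave φ) (Y : RISpace) : Prop :=
  HardyBounded hφ Y ∧ ∀ Z : RISpace, HardyBounded hφ Z → Y.carrier ⊆ Z.carrier

end RestrictedType

end

namespace RestrictedType

theorem tsum_zpow_two_le (m : ℤ) :
    ∑' k : ℤ, (if k ≤ m then (2 : ℝ≥0∞) ^ k else 0) = 2 * 2 ^ m := by
  have hinj : Function.Injective (fun j : ℕ => m - (j : ℤ)) := fun a b h => by
    simp only at h; omega
  rw [← hinj.tsum_eq]
  · have : ∀ j : ℕ, (if m - (j : ℤ) ≤ m then (2 : ℝ≥0∞) ^ (m - (j : ℤ)) else 0)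
        = 2 ^ m * (2⁻¹) ^ j := fun j => by
      rw [if_pos (by omega), sub_eq_add_neg, ENNReal.zpow_add (by simp) (by simp),
        ENNReal.zpow_neg, zpow_natCast, ENNReal.inv_pow]
    simp_rw [this]
    rw [ENNReal.tsum_mul_left, ENNReal.tsum_geometric, ENNReal.one_sub_inv_two, inv_inv, mul_comm]
  · intro k hk
    have hkm : k ≤ m := by
      by_contra h
      simp [h] at hk
    exact ⟨(m - k).toNat, by simp only; omega⟩

/-- The dyadic layer-cake sum `∑ 2 ^ k` over the integers `k` with `2 ^ k < y`. -/
noncomputable def dyadicSum (y : ℝ≥0∞) : ℝ≥0∞ :=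
  ∑' k : ℤ, (if (2 : ℝ≥0∞) ^ k < y then (2 : ℝ≥0∞) ^ k else 0)

theorem dyadicSum_bounds {y : ℝ≥0∞} (hy : y ≠ ∞) : y ≤ dyadicSum y ∧ dyadicSum y ≤ 2 * y := by
  rcases eq_or_ne y 0 with rfl | h0
  · simp [dyadicSum]
  obtain ⟨m, hm1, hm2⟩ := ENNReal.exists_mem_Ioc_zpow h0 hy (y := 2) (by norm_num) (by simp)
  have hiff : ∀ k : ℤ, (2 : ℝ≥0∞) ^ k < y ↔ k ≤ m := by
    intro k
    constructor
    · intro h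
      by_contra hk
      have : (2 : ℝ≥0∞) ^ (m + 1) ≤ 2 ^ k :=
        ENNReal.zpow_le_of_le (by norm_num) (by omega)
      exact absurd (hm2.trans this) (not_le.2 h)
    · exact fun h => (ENNReal.zpow_le_of_le (by norm_num) h).trans_lt hm1
  have : dyadicSum y = 2 * 2 ^ m := by
    rw [dyadicSum, ← tsum_zpow_two_le]
    simp_rw [hiff]
  rw [this]
  refine ⟨hm2.trans ?_, by gcongr⟩
  rw [ENNReal.zpow_add (by simp) (by simp), zpow_one, mul_comm]

theorem dyadicSum_mono {x y : ℝ≥0∞} (h : x ≤ y) : dyadicSum x ≤ dyadicSum y := by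
  refine ENNReal.tsum_le_tsum fun k => ?_
  split_ifs with h1 h2
  · exact le_rfl
  · exact absurd (h1.trans_le h) h2
  · exact zero_le
  · exact le_rfl

theorem le_dyadicSum (y : ℝ≥0∞) : y ≤ dyadicSum y :=
  le_of_forall_lt fun _ hx => by
    obtain ⟨z, hxz, hzy⟩ := exists_between hx
    exact hxz.trans_le ((dyadicSum_bounds hzy.ne_top).1.trans (dyadicSum_mono hzy.le))

theorem dyadicSum_le (y : ℝ≥0∞) : dyadicSum y ≤ 2 * y := by
  rcases eq_or_ne y ∞ with rfl | h
  · simp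
  · exact (dyadicSum_bounds h).2

theorem lintegral_dyadicSum {α : Type*} [MeasurableSpace α] {μ : Measure α} {h : α → ℝ≥0∞}
    (hh : AEMeasurable h μ) :
    ∫⁻ x, dyadicSum (h x) ∂μ = ∑' k : ℤ, 2 ^ k * μ {x | (2 : ℝ≥0∞) ^ k < h x} := by
  have hs : ∀ k : ℤ, NullMeasurableSet {x | (2 : ℝ≥0∞) ^ k < h x} μ := fun k =>
    nullMeasurableSet_lt aemeasurable_const hh
  have he : ∀ k : ℤ, (fun x => if (2 : ℝ≥0∞) ^ k < h x then (2 : ℝ≥0∞) ^ k else 0) =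
      {x | (2 : ℝ≥0∞) ^ k < h x}.indicator (fun _ => 2 ^ k) := fun k => by
    ext x; simp [indicator]
  unfold dyadicSum
  rw [lintegral_tsum]
  · refine tsum_congr fun k => ?_
    rw [he k, lintegral_indicator_const₀ (hs k)]
  · intro k
    rw [he k]
    exact aemeasurable_const.indicator₀ (hs k)

/-! ### Distribution function and rearrangement -/

theorem distribution_anti (f : ℝ → ℝ≥0∞) : Antitone (distribution f) :=
  fun _ _ h => measure_mono fun _ hx => h.trans_lt hx

theorem lt_rearrangement_iff (f : ℝ → ℝ) (t : ℝ) (l : ℝ≥0∞) :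
    l < rearrangement f t ↔ ENNReal.ofReal t < distribution (fun x => ‖f x‖ₑ) l := by
  constructor
  · intro h
    by_contra hn
    have hle : rearrangement f t ≤ l := sInf_le (not_lt.1 hn)
    exact absurd hle (not_le.2 h)
  · intro h
    have hl : l < ∞ := by
      rw [lt_top_iff_ne_top]
      rintro rfl
      simp [distribution] at h
    obtain ⟨u, hu, hul, hlim⟩ := exists_seq_strictAnti_tendsto' hl
    have hU : {x | l < ‖f x‖ₑ} = ⋃ n, {x | u n < ‖f x‖ₑ} := by
      ext x
      simp only [mem_ofPred_eq, mem_iUnion]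
      refine ⟨fun hx => (hlim.eventually_lt_const hx).exists, fun ⟨n, hn⟩ => (hul n).1.trans hn⟩
    have hmono : Monotone fun n => {x | u n < ‖f x‖ₑ} := fun m n hmn x hx =>
      (hu.antitone hmn).trans_lt hx
    rw [distribution, hU, hmono.measure_iUnion, lt_iSup_iff] at h
    obtain ⟨n, hn⟩ := h
    refine (hul n).1.trans_le (le_sInf fun l' hl' => ?_)
    by_contra hlt
    exact absurd (hl'.trans_lt hn) (not_lt.2 (distribution_anti _ (not_le.1 hlt).le))

theorem rearrangement_anti (f : ℝ → ℝ) : Antitone (rearrangement f) := fun _ _ h =>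
  sInf_le_sInf fun _ hl => le_trans hl (ENNReal.ofReal_le_ofReal h)

theorem measurable_rearrangement (f : ℝ → ℝ) : Measurable (rearrangement f) :=
  (rearrangement_anti f).measurable

namespace QuasiConcave

variable {φ ψ : ℝ → ℝ}

theorem measure_Iio (hφ : QuasiConcave φ) {t : ℝ} (ht : 0 < t) :
    hφ.measure (Iio t) = ENNReal.ofReal (φ t) := by
  set g : ℝ → ℝ := fun t : ℝ => if t ≤ 0 then 0 else φ t with hg
  set F := hφ.monotone_extend.stieltjesFunction with hF
  have hgpos : ∀ s, 0 < s → g s = φ s := fun s hs => if_neg (not_le.2 hs)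
  have hle : ∀ s, g s ≤ F s := fun s => hφ.monotone_extend.le_rightLim le_rfl
  have hlt : ∀ s r, s < r → F s ≤ g r := fun s r h => hφ.monotone_extend.rightLim_le h
  have hbot : Filter.Tendsto F Filter.atBot (nhds 0) := by
    refine tendsto_const_nhds.congr' ?_
    filter_upwards [Filter.eventually_lt_atBot (0 : ℝ)] with s hs
    refine le_antisymm ?_ ?_
    · simpa [hg, hs.le] using hle s
    · simpa [hg] using hlt s 0 hs
  have hL : Function.leftLim F t = φ t := by
    refine le_antisymm ?_ ?_
    · refine le_of_tendsto (F.mono.tendsto_leftLim t) ?_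
      filter_upwards [self_mem_nhdsWithin] with s hs
      exact (hlt s t hs).trans_eq (hgpos t ht)
    · have h1 : Filter.Tendsto (fun s : ℝ => s * (φ t / t)) (nhdsWithin t (Iio t))
          (nhds (t * (φ t / t))) :=
        ((continuous_id.mul continuous_const).tendsto t).mono_left nhdsWithin_le_nhds
      rw [mul_div_cancel₀ _ ht.ne'] at h1
      refine le_of_tendsto h1 ?_
      have h2 : ∀ᶠ s in nhdsWithin t (Iio t), 0 < s :=
        nhdsWithin_le_nhds (lt_mem_nhds ht)
      filter_upwards [self_mem_nhdsWithin, h2] with s hs hs0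
      have h3 := hφ.div_anti s t hs0 (le_of_lt hs)
      rw [le_div_iff₀ hs0] at h3
      calc s * (φ t / t) = φ t / t * s := mul_comm _ _
        _ ≤ φ s := h3
        _ ≤ F s := (hgpos s hs0).symm.trans_le (hle s)
        _ ≤ _ := F.mono.le_leftLim hs
  rw [measure, ← hF, F.measure_Iio hbot, hL, sub_zero]

/-- The `dφ`-measure of `[0, a)` for `a ∈ [0, ∞]`. -/
noncomputable def mass (hφ : QuasiConcave φ) (a : ℝ≥0∞) : ℝ≥0∞ :=
  hφ.measure {t | ENNReal.ofReal t < a}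

theorem mass_ofReal (hφ : QuasiConcave φ) {t : ℝ} (ht : 0 < t) :
    hφ.mass (ENNReal.ofReal t) = ENNReal.ofReal (φ t) := by
  rw [← hφ.measure_Iio ht, mass]
  congr 1
  ext s
  simp [ENNReal.ofReal_lt_ofReal_iff ht]

theorem mass_mono (hφ : QuasiConcave φ) {a b : ℝ≥0∞} (h : a ≤ b) : hφ.mass a ≤ hφ.mass b :=
  measure_mono fun _ hx => lt_of_lt_of_le hx h

theorem mass_zero (hφ : QuasiConcave φ) : hφ.mass 0 = 0 := by simp [mass]

theorem mass_top (hφ : QuasiConcave φ) :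
    hφ.mass ∞ = ⨆ n : ℕ, hφ.mass (ENNReal.ofReal (n + 1)) := by
  have hmono : Monotone fun n : ℕ => {t : ℝ | ENNReal.ofReal t < ENNReal.ofReal (n + 1)} :=
    fun m n h t ht => ht.trans_le (ENNReal.ofReal_le_ofReal (by gcongr))
  rw [mass]
  simp only [mass]
  rw [← hmono.measure_iUnion]
  congr 1
  ext t
  simp only [ENNReal.ofReal_lt_top, ofPred_true, mem_univ, mem_iUnion, mem_ofPred_eq, true_iff]
  obtain ⟨n, hn⟩ := exists_nat_gt t
  exact ⟨n, (ENNReal.ofReal_lt_ofReal_iff (by positivity)).2 (by linarith)⟩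

theorem mass_le_mass (hφ : QuasiConcave φ) (hψ : QuasiConcave ψ) (C : ℝ≥0)
    (h : ∀ t, 0 < t → ψ t ≤ C * φ t) (a : ℝ≥0∞) : hψ.mass a ≤ C * hφ.mass a := by
  have hreal : ∀ t : ℝ, 0 < t →
      hψ.mass (ENNReal.ofReal t) ≤ C * hφ.mass (ENNReal.ofReal t) := fun t ht => by
    rw [mass_ofReal _ ht, mass_ofReal _ ht, ← ENNReal.ofReal_coe_nnreal,
      ← ENNReal.ofReal_mul C.coe_nonneg]
    exact ENNReal.ofReal_le_ofReal (h t ht)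
  rcases eq_or_ne a ∞ with rfl | ha
  · rw [hψ.mass_top]
    exact iSup_le fun n => (hreal _ (by positivity)).trans
      (mul_le_mul_right (hφ.mass_mono le_top) _)
  rcases eq_or_ne a 0 with rfl | h0
  · simp [mass_zero]
  · rw [← ENNReal.ofReal_toReal ha]
    exact hreal _ (ENNReal.toReal_pos h0 ha)

theorem measure_lt_rearrangement (hφ : QuasiConcave φ) (f : ℝ → ℝ) (l : ℝ≥0∞) :
    hφ.measure {t | l < rearrangement f t} = hφ.mass (distribution (fun x => ‖f x‖ₑ) l) := by
  simp_rw [lt_rearrangement_iff, mass]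

end QuasiConcave

theorem lorentzNorm_le_tsum {φ : ℝ → ℝ} (hφ : QuasiConcave φ) (f : ℝ → ℝ) :
    lorentzNorm hφ f ≤
      ∑' k : ℤ, 2 ^ k * hφ.mass (distribution (fun x => ‖f x‖ₑ) (2 ^ k)) := by
  simp_rw [← hφ.measure_lt_rearrangement]
  rw [← lintegral_dyadicSum (measurable_rearrangement f).aemeasurable]
  exact lintegral_mono fun t => le_dyadicSum _

theorem tsum_le_lorentzNorm {φ : ℝ → ℝ} (hφ : QuasiConcave φ) (f : ℝ → ℝ) :
    ∑' k : ℤ, 2 ^ k * hφ.mass (distribution (fun x => ‖f x‖ₑ) (2 ^ k)) ≤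
      2 * lorentzNorm hφ f := by
  simp_rw [← hφ.measure_lt_rearrangement]
  rw [← lintegral_dyadicSum (measurable_rearrangement f).aemeasurable, lorentzNorm,
    ← lintegral_const_mul _ (measurable_rearrangement f)]
  exact lintegral_mono fun t => dyadicSum_le _

theorem lorentzNorm_le_of_le {φ ψ : ℝ → ℝ} (hφ : QuasiConcave φ) (hψ : QuasiConcave ψ) (C : ℝ≥0)
    (h : ∀ t, 0 < t → ψ t ≤ C * φ t) (f : ℝ → ℝ) :
    lorentzNorm hψ f ≤ C * (2 * lorentzNorm hφ f) := by
  refine (lorentzNorm_le_tsum hψ f).trans ?_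
  refine le_trans ?_ (mul_le_mul_right (tsum_le_lorentzNorm hφ f) _)
  rw [← ENNReal.tsum_mul_left]
  refine ENNReal.tsum_le_tsum fun k => ?_
  rw [mul_left_comm]
  exact mul_le_mul_right (hφ.mass_le_mass hψ C h _) _

theorem lorentzSpace_subset_of_le {φ ψ : ℝ → ℝ} (hφ : QuasiConcave φ) (hψ : QuasiConcave ψ)
    (C : ℝ≥0) (h : ∀ t, 0 < t → ψ t ≤ C * φ t) : lorentzSpace hφ ⊆ lorentzSpace hψ :=
  fun f hf => ⟨hf.1, (lorentzNorm_le_of_le hφ hψ C h f).trans_lt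
    (ENNReal.mul_lt_top (by simp) (ENNReal.mul_lt_top (by simp) hf.2))⟩

theorem halfLine_Iio (t : ℝ) : halfLine (Iio t) = ENNReal.ofReal t := by
  rw [halfLine, Measure.restrict_apply measurableSet_Iio, inter_comm, Ioi_inter_Iio,
    Real.volume_Ioo, sub_zero]

theorem halfLine_Iic (t : ℝ) : halfLine (Iic t) = ENNReal.ofReal t := by
  rw [halfLine, Measure.restrict_apply measurableSet_Iic, inter_comm, Ioi_inter_Iic,
    Real.volume_Ioc, sub_zero]

theorem rearrangement_le_of_antitone {f : ℝ → ℝ} {F : ℝ → ℝ≥0∞} (hF : Antitone F)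
    (hf : ∀ x, ‖f x‖ₑ ≤ F x) (t : ℝ) : rearrangement f t ≤ F t := by
  refine sInf_le ?_
  change halfLine {x | F t < ‖f x‖ₑ} ≤ ENNReal.ofReal t
  rw [← halfLine_Iio]
  refine measure_mono fun x hx => ?_
  by_contra hxt
  exact absurd ((hf x).trans (hF (not_lt.1 hxt))) (not_le.2 hx)

theorem le_rearrangement {f : ℝ → ℝ} {c : ℝ≥0∞} {a : ℝ}
    (hf : ∀ x, 0 < x → x < a → c ≤ ‖f x‖ₑ) {t : ℝ} (ha : 0 < a) (ht : t < a) :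
    c ≤ rearrangement f t := by
  refine le_of_forall_lt fun l hl => ?_
  rw [lt_rearrangement_iff]
  refine ((ENNReal.ofReal_lt_ofReal_iff ha).2 ht).trans_le ?_
  rw [← halfLine_Iio]
  refine measure_mono_ae ?_
  have hmem : ∀ᵐ x ∂halfLine, x ∈ Ioi (0 : ℝ) := ae_restrict_mem measurableSet_Ioi
  filter_upwards [hmem] with x hx0 hxa
  exact hl.trans_le (hf x hx0 hxa)

theorem exists_le_of_lorentzSpace_subset {φ ψ : ℝ → ℝ} (hφ : QuasiConcave φ)
    (hψ : QuasiConcave ψ) (h : lorentzSpace hφ ⊆ lorentzSpace hψ) :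
    ∃ C : ℝ≥0, ∀ t, 0 < t → ψ t ≤ C * φ t := by
  by_contra! hcon
  choose t ht0 ht using fun n : ℕ => hcon (4 ^ n)
  set c : ℕ → ℝ≥0∞ := fun n => ENNReal.ofReal ((1 / 2) ^ n / φ (t n)) with hc
  have hcφ : ∀ n, c n * ENNReal.ofReal (φ (t n)) = 2⁻¹ ^ n := fun n => by
    have := hφ.pos _ (ht0 n)
    rw [hc, ← ENNReal.ofReal_mul (by positivity), div_mul_cancel₀ _ this.ne',
      ENNReal.ofReal_pow (by norm_num)]
    congr 1
    rw [one_div, ENNReal.ofReal_inv_of_pos (by norm_num)]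
    simp
  have hsum : ∑' n : ℕ, (2⁻¹ : ℝ≥0∞) ^ n = 2 := by
    rw [ENNReal.tsum_geometric, ENNReal.one_sub_inv_two, inv_inv]
  set F : ℝ → ℝ≥0∞ := fun x => ∑' n, (Iio (t n)).indicator (fun _ => c n) x with hF
  have hanti : Antitone F := fun x y hxy => ENNReal.tsum_le_tsum fun n => by
    by_cases hy : y < t n
    · simp [hy, hxy.trans_lt hy]
    · simp [hy]
  have hfin : ∀ x, 0 < x → F x < ∞ := fun x hx => by
    have hb : F x * ENNReal.ofReal (φ x) ≤ 2 := by
      rw [hF, ← hsum, ← ENNReal.tsum_mul_right]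
      refine ENNReal.tsum_le_tsum fun n => ?_
      by_cases hxn : x < t n
      · rw [indicator_of_mem (by exact hxn), ← hcφ]
        gcongr
        exact hφ.mono _ _ hx hxn.le
      · rw [indicator_of_notMem (by exact hxn)]
        simp
    by_contra htop
    rw [not_lt, top_le_iff] at htop
    rw [htop, ENNReal.top_mul (by simpa using hφ.pos x hx)] at hb
    simp at hb
  set f : ℝ → ℝ := fun x => (F x).toReal with hf
  have hfle : ∀ x, ‖f x‖ₑ ≤ F x := fun x => by
    rw [hf, Real.enorm_of_nonneg ENNReal.toReal_nonneg]
    exact ENNReal.ofReal_toReal_le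
  have hfeq : ∀ x, 0 < x → ‖f x‖ₑ = F x := fun x hx => by
    rw [hf, Real.enorm_of_nonneg ENNReal.toReal_nonneg]
    exact ENNReal.ofReal_toReal (hfin x hx).ne
  have hmem : f ∈ lorentzSpace hφ := by
    refine ⟨hanti.measurable.ennreal_toReal.aemeasurable, ?_⟩
    calc lorentzNorm hφ f ≤ ∫⁻ x, F x ∂hφ.measure :=
          lintegral_mono fun s => rearrangement_le_of_antitone hanti hfle s
      _ = 2 := by
        rw [hF, lintegral_tsum fun n => (measurable_const.indicator measurableSet_Iio).aemeasurable,
          ← hsum]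
        refine tsum_congr fun n => ?_
        rw [lintegral_indicator_const measurableSet_Iio, hφ.measure_Iio (ht0 n), hcφ]
      _ < ∞ := by simp
  have hlow : ∀ n, ENNReal.ofReal (2 ^ n) ≤ lorentzNorm hψ f := fun n => by
    have hpos := hφ.pos _ (ht0 n)
    calc ENNReal.ofReal (2 ^ n) ≤ ENNReal.ofReal ((1 / 2) ^ n / φ (t n) * ψ (t n)) := by
          refine ENNReal.ofReal_le_ofReal ?_
          have h1 : (4 : ℝ) ^ n * φ (t n) < ψ (t n) := by simpa using ht n
          calc (2 : ℝ) ^ n = (1 / 2) ^ n / φ (t n) * (4 ^ n * φ (t n)) := by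
                field_simp
                rw [← mul_pow]
                norm_num
            _ ≤ _ := by gcongr
      _ = c n * hψ.measure (Iio (t n)) := by
          rw [hψ.measure_Iio (ht0 n), hc, ENNReal.ofReal_mul (by positivity)]
      _ = ∫⁻ s, (Iio (t n)).indicator (fun _ => c n) s ∂hψ.measure :=
          (lintegral_indicator_const measurableSet_Iio _).symm
      _ ≤ _ := by
          refine lintegral_mono fun s => indicator_le (fun s hs => ?_) s
          refine le_rearrangement (fun x hx hxa => ?_) (ht0 n) hs
          rw [hfeq x hx]
          calc c n = (Iio (t n)).indicator (fun _ => c n) x := by simp [hxa]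
            _ ≤ F x := ENNReal.le_tsum n
  have htop := (h hmem).2
  obtain ⟨n, hn⟩ := pow_unbounded_of_one_lt (lorentzNorm hψ f).toReal (one_lt_two)
  have := hlow n
  rw [ENNReal.ofReal_le_iff_le_toReal htop.ne] at this
  exact absurd this (not_le.2 hn)

namespace RISpace

variable (X Y : RISpace)

theorem ρ_zero : X.ρ (fun _ => 0) = 0 :=
  (X.eq_zero_iff _ aemeasurable_const).2 Filter.EventuallyEq.rfl

theorem ρ_sum_le {ι : Type*} (s : Finset ι) (f : ι → ℝ → ℝ≥0∞)
    (hf : ∀ i, AEMeasurable (f i) halfLine) :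
    X.ρ (fun x => ∑ i ∈ s, f i x) ≤ ∑ i ∈ s, X.ρ (f i) := by
  classical
  induction s using Finset.induction_on with
  | empty => simp [X.ρ_zero]
  | insert i s hi ih =>
    simp_rw [Finset.sum_insert hi]
    exact (X.add_le _ _ (hf i) (Finset.aemeasurable_fun_sum s fun j _ => hf j)).trans
      (add_le_add le_rfl ih)

theorem ρ_tsum_nat_le (f : ℕ → ℝ → ℝ≥0∞) (hf : ∀ n, AEMeasurable (f n) halfLine) :
    X.ρ (fun x => ∑' n, f n x) ≤ ∑' n, X.ρ (f n) := by
  simp_rw [ENNReal.tsum_eq_iSup_nat]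
  rw [X.fatou (fun n x => ∑ i ∈ Finset.range n, f i x)
    (fun n => Finset.aemeasurable_fun_sum _ fun j _ => hf j)
    (Filter.Eventually.of_forall fun x m n hmn =>
      Finset.sum_le_sum_of_subset (Finset.range_mono hmn))]
  exact iSup_mono fun n => X.ρ_sum_le _ f hf

/-- The function norm is countably subadditive. -/
theorem ρ_tsum_le {ι : Type*} [Denumerable ι] (f : ι → ℝ → ℝ≥0∞)
    (hf : ∀ i, AEMeasurable (f i) halfLine) :
    X.ρ (fun x => ∑' i, f i x) ≤ ∑' i, X.ρ (f i) := by
  have e := (Denumerable.eqv ι).symm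
  rw [← e.tsum_eq]
  simp_rw [← e.tsum_eq (fun i => f i _)]
  exact X.ρ_tsum_nat_le _ fun n => hf _

variable {X Y}

theorem ae_lt_top {f : ℝ → ℝ≥0∞} (hf : AEMeasurable f halfLine) (h : X.ρ f < ∞) :
    ∀ᵐ x ∂halfLine, f x < ∞ := by
  have hU : (⋃ n : ℕ, Iic (n : ℝ)) = univ := by
    ext x
    simpa using exists_nat_ge x
  rw [← Measure.restrict_univ (μ := halfLine), ← hU, ae_restrict_iUnion_iff]
  intro n
  obtain ⟨C, hC⟩ := X.setLIntegral_le (Iic (n : ℝ)) measurableSet_Iic (by simp [halfLine_Iic])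
  exact ae_lt_top' hf.restrict ((hC f hf).trans_lt (ENNReal.mul_lt_top (by simp) h)).ne

theorem ρ_lt_top_of_subset (h : Y.carrier ⊆ X.carrier) {f : ℝ → ℝ≥0∞}
    (hf : AEMeasurable f halfLine) (hY : Y.ρ f < ∞) : X.ρ f < ∞ := by
  have hlt := ae_lt_top hf hY
  have hae : ∀ᵐ x ∂halfLine, ‖(f x).toReal‖ₑ = f x := by
    filter_upwards [hlt] with x hx
    rw [Real.enorm_of_nonneg ENNReal.toReal_nonneg, ENNReal.ofReal_toReal hx.ne]
  have hm : AEMeasurable (fun x => (f x).toReal) halfLine := hf.ennreal_toReal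
  have hin : (fun x => (f x).toReal) ∈ X.carrier :=
    h ⟨hm, (Y.mono _ _ hm.enorm hf (hae.mono fun x hx => hx.le)).trans_lt hY⟩
  exact (X.mono _ _ hf hm.enorm (hae.mono fun x hx => hx.ge)).trans_lt hin.2

/-- An inclusion between r.i. spaces is bounded. -/
theorem exists_ρ_le_of_subset (h : Y.carrier ⊆ X.carrier) :
    ∃ C : ℝ≥0, ∀ f, AEMeasurable f halfLine → X.ρ f ≤ C * Y.ρ f := by
  by_contra! hcon
  choose f hfm hf using fun n : ℕ => hcon (4 ^ n)
  have hY0 : ∀ n, Y.ρ (f n) ≠ 0 := fun n h0 => by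
    have h1 := (X.eq_zero_iff _ (hfm n)).2 ((Y.eq_zero_iff _ (hfm n)).1 h0)
    have h2 := hf n
    simp [h0, h1] at h2
  have hYt : ∀ n, Y.ρ (f n) ≠ ∞ := fun n h0 => by
    have h2 := hf n
    simp [h0, ENNReal.mul_top] at h2
  set a : ℕ → ℝ≥0 := fun n => 2⁻¹ ^ n * (Y.ρ (f n)).toNNReal⁻¹ with ha
  have haY : ∀ n, (a n : ℝ≥0∞) * Y.ρ (f n) = 2⁻¹ ^ n := fun n => by
    have h0 : (Y.ρ (f n)).toNNReal ≠ 0 := by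
      simp [ENNReal.toNNReal_eq_zero_iff, hY0 n, hYt n]
    conv_lhs => rw [← ENNReal.coe_toNNReal (hYt n)]
    rw [← ENNReal.coe_mul, ha]
    simp only
    rw [mul_assoc, inv_mul_cancel₀ h0, mul_one]
    simp [ENNReal.inv_pow]
  have hm : ∀ n, AEMeasurable (fun x => (a n : ℝ≥0∞) * f n x) halfLine := fun n =>
    (hfm n).const_mul _
  have hFm : AEMeasurable (fun x => ∑' n, (a n : ℝ≥0∞) * f n x) halfLine :=
    AEMeasurable.tsum hm
  have hYF : Y.ρ (fun x => ∑' n, (a n : ℝ≥0∞) * f n x) < ∞ := by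
    refine (Y.ρ_tsum_nat_le _ hm).trans_lt ?_
    simp_rw [Y.smul _ _ (hfm _), haY]
    rw [ENNReal.tsum_geometric, ENNReal.one_sub_inv_two, inv_inv]
    simp
  have hXF := ρ_lt_top_of_subset h hFm hYF
  have hlow : ∀ n, (2 : ℝ≥0∞) ^ n ≤ X.ρ (fun x => ∑' n, (a n : ℝ≥0∞) * f n x) := fun n => by
    calc (2 : ℝ≥0∞) ^ n = 4 ^ n * 2⁻¹ ^ n := by
          rw [← mul_pow]
          congr 1
          rw [show (4 : ℝ≥0∞) = 2 * 2 by norm_num, mul_assoc, ENNReal.mul_inv_cancel] <;> simp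
      _ = a n * (4 ^ n * Y.ρ (f n)) := by rw [← haY]; ring
      _ ≤ a n * X.ρ (f n) := by
          gcongr
          simpa using (hf n).le
      _ = X.ρ (fun x => a n * f n x) := (X.smul _ _ (hfm n)).symm
      _ ≤ _ := X.mono _ _ (hm n) hFm (Filter.Eventually.of_forall fun x =>
          ENNReal.le_tsum (f := fun n => (a n : ℝ≥0∞) * f n x) n)
  obtain ⟨n, hn⟩ := ENNReal.exists_nat_gt hXF.ne
  refine absurd (hlow n) (not_le.2 (hn.trans_le ?_))
  exact_mod_cast n.lt_two_pow_self.le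

/-- The space with norm multiplied by a positive constant. -/
noncomputable def scale (X : RISpace) (c : ℝ≥0) (hc : c ≠ 0) : RISpace where
  ρ f := c * X.ρ f
  eq_zero_iff f hf := by simp [hc, X.eq_zero_iff f hf]
  smul a f hf := by rw [X.smul a f hf, mul_left_comm]
  add_le f g hf hg := by
    rw [← mul_add]
    exact mul_le_mul_right (X.add_le f g hf hg) _
  mono f g hf hg h := mul_le_mul_right (X.mono f g hf hg h) _
  fatou f hf hmono := by rw [X.fatou f hf hmono, ENNReal.mul_iSup]
  indicator_lt_top E hE hfin := ENNReal.mul_lt_top (by simp) (X.indicator_lt_top E hE hfin)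
  setLIntegral_le E hE hfin := by
    obtain ⟨C, hC⟩ := X.setLIntegral_le E hE hfin
    refine ⟨C * c⁻¹, fun f hf => (hC f hf).trans_eq ?_⟩
    rw [← mul_assoc, ← ENNReal.coe_mul, mul_assoc, inv_mul_cancel₀ hc, mul_one]
  rearrangement_invariant f g hf hg h := by rw [X.rearrangement_invariant f g hf hg h]

/-- The supremum of a family of r.i. norms that is finite on sets of finite measure. -/
noncomputable def sup {ι : Type*} (i₀ : ι) (Z : ι → RISpace)
    (hfin : ∀ E : Set ℝ, MeasurableSet E → halfLine E < ∞ →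
      ⨆ i, (Z i).ρ (E.indicator (fun _ => 1)) < ∞) : RISpace where
  ρ f := ⨆ i, (Z i).ρ f
  eq_zero_iff f hf := by
    simp only [ENNReal.iSup_eq_zero, (Z _).eq_zero_iff f hf]
    exact ⟨fun h => h i₀, fun h _ => h⟩
  smul a f hf := by simp_rw [(Z _).smul a f hf, ENNReal.mul_iSup]
  add_le f g hf hg := iSup_le fun i => ((Z i).add_le f g hf hg).trans
    (add_le_add (le_iSup (fun i => (Z i).ρ f) i) (le_iSup (fun i => (Z i).ρ g) i))
  mono f g hf hg h := iSup_mono fun i => (Z i).mono f g hf hg h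
  fatou f hf hmono := by
    simp_rw [(Z _).fatou f hf hmono]
    exact iSup_comm
  indicator_lt_top := hfin
  setLIntegral_le E hE hE' := by
    obtain ⟨C, hC⟩ := (Z i₀).setLIntegral_le E hE hE'
    exact ⟨C, fun f hf => (hC f hf).trans
      (mul_le_mul_right (le_iSup (fun i => (Z i).ρ f) i₀) _)⟩
  rearrangement_invariant f g hf hg h := by
    simp_rw [(Z _).rearrangement_invariant f g hf hg h]

end RISpace

theorem hardy_aemeasurable {f : ℝ → ℝ} (hf : AEMeasurable f halfLine) :
    AEMeasurable (hardy f) halfLine := by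
  set g := hf.mk f with hg
  have hgm : Measurable g := hf.measurable_mk
  have heq : hardy f = fun t => 1 / t * ∫ r, (Ioc 0 t).indicator g r := by
    ext t
    rw [hardy, integral_indicator measurableSet_Ioc]
    congr 1
    refine integral_congr_ae ?_
    exact (Measure.absolutelyContinuous_of_le
      (Measure.restrict_mono Ioc_subset_Ioi_self le_rfl)).ae_le hf.ae_eq_mk
  have hset : MeasurableSet {p : ℝ × ℝ | 0 < p.2 ∧ p.2 ≤ p.1} :=
    (measurableSet_lt measurable_const measurable_snd).inter
      (measurableSet_le measurable_snd measurable_fst)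
  have hint : StronglyMeasurable fun t : ℝ => ∫ r, (Ioc 0 t).indicator g r :=
    StronglyMeasurable.integral_prod_right' (ν := volume)
      (f := {p : ℝ × ℝ | 0 < p.2 ∧ p.2 ≤ p.1}.indicator fun p => g p.2)
      ((hgm.comp measurable_snd).indicator hset).stronglyMeasurable
  rw [heq]
  exact ((measurable_const.div measurable_id).mul hint.measurable).aemeasurable

/-- The averages `t ↦ |E ∩ (0, t]| / t`. -/
noncomputable def setAverage (E : Set ℝ) (t : ℝ) : ℝ≥0∞ :=
  ENNReal.ofReal (1 / t) * volume.restrict (Ioc 0 t) E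

theorem measurable_setAverage (E : Set ℝ) : Measurable (setAverage E) := by
  have hmono : Monotone fun t : ℝ => volume.restrict (Ioc 0 t) E := fun s t hst =>
    Measure.le_iff'.1 (Measure.restrict_mono (Ioc_subset_Ioc_right hst) le_rfl) E
  exact (ENNReal.measurable_ofReal.comp (measurable_const.div measurable_id)).mul hmono.measurable

theorem setAverage_le {E : Set ℝ} {a : ℝ} (hE : halfLine E ≤ ENNReal.ofReal a)
    {t : ℝ} (ht : 0 < t) : setAverage E t ≤ ENNReal.ofReal (min 1 (a / t)) := by
  have h1 : volume.restrict (Ioc 0 t) E ≤ ENNReal.ofReal a :=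
    (Measure.le_iff'.1 (Measure.restrict_mono Ioc_subset_Ioi_self le_rfl) E).trans hE
  have h2 : volume.restrict (Ioc 0 t) E ≤ ENNReal.ofReal t :=
    (measure_mono (subset_univ _)).trans_eq (by simp)
  have h3 : volume.restrict (Ioc 0 t) E ≤ ENNReal.ofReal (min t a) := by
    rw [ENNReal.ofReal_min]
    exact le_min h2 h1
  calc setAverage E t ≤ ENNReal.ofReal (1 / t) * ENNReal.ofReal (min t a) :=
        mul_le_mul_right h3 _
    _ = ENNReal.ofReal (min 1 (a / t)) := by
        rw [← ENNReal.ofReal_mul (by positivity), mul_min_of_nonneg _ _ (by positivity)]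
        congr 2
        · field_simp
        · ring

theorem enorm_hardy_le {f : ℝ → ℝ} (hf : AEMeasurable f halfLine) {t : ℝ} (ht : 0 < t) :
    ‖hardy f t‖ₑ ≤ ∑' k : ℤ, 2 ^ k * setAverage {x | (2 : ℝ≥0∞) ^ k < ‖f x‖ₑ} t := by
  have hf' : AEMeasurable f (volume.restrict (Ioc 0 t)) :=
    hf.mono_measure (Measure.restrict_mono Ioc_subset_Ioi_self le_rfl)
  calc ‖hardy f t‖ₑ = ENNReal.ofReal (1 / t) * ‖∫ r in Ioc 0 t, f r‖ₑ := by
        rw [hardy, enorm_mul, Real.enorm_of_nonneg (by positivity)]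
    _ ≤ ENNReal.ofReal (1 / t) * ∫⁻ r in Ioc 0 t, dyadicSum ‖f r‖ₑ :=
        mul_le_mul_right ((enorm_integral_le_lintegral_enorm _).trans
          (lintegral_mono fun r => le_dyadicSum _)) _
    _ = _ := by
        rw [lintegral_dyadicSum hf'.enorm, ← ENNReal.tsum_mul_left]
        exact tsum_congr fun k => mul_left_comm _ _ _

theorem ae_halfLine_pos : ∀ᵐ x ∂halfLine, 0 < x := ae_restrict_mem measurableSet_Ioi

theorem measurable_minKernel (t : ℝ) :
    Measurable fun s : ℝ => ENNReal.ofReal (min 1 (t / s)) := by fun_prop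

theorem ρ_setAverage_le {φ : ℝ → ℝ} (hφ : QuasiConcave φ) (Z : RISpace) (C : ℝ≥0)
    (h : ∀ t, 0 < t → Z.ρ (fun s => ENNReal.ofReal (min 1 (t / s))) ≤ C * ENNReal.ofReal (φ t))
    (E : Set ℝ) : Z.ρ (setAverage E) ≤ C * hφ.mass (halfLine E) := by
  have hfin : ∀ E : Set ℝ, halfLine E ≠ ∞ → Z.ρ (setAverage E) ≤ C * hφ.mass (halfLine E) := by
    intro E hE
    rcases eq_or_ne (halfLine E) 0 with h0 | h0
    · have : Z.ρ (setAverage E) = 0 := by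
        rw [Z.eq_zero_iff _ (measurable_setAverage E).aemeasurable]
        filter_upwards [ae_halfLine_pos] with t ht
        have := setAverage_le (a := 0) (h0.trans_le (by simp)) ht
        simpa using this
      simp [this]
    · have ha := ENNReal.toReal_pos h0 hE
      rw [← ENNReal.ofReal_toReal hE, hφ.mass_ofReal ha]
      refine le_trans ?_ (h _ ha)
      refine Z.mono _ _ (measurable_setAverage E).aemeasurable
        (measurable_minKernel _).aemeasurable ?_
      filter_upwards [ae_halfLine_pos] with t ht
      exact setAverage_le (ENNReal.ofReal_toReal hE).ge ht
  rcases eq_or_ne (halfLine E) ∞ with htop | hE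
  · have hm : ∀ n : ℕ, AEMeasurable (setAverage (E ∩ Iic (n : ℝ))) halfLine := fun n =>
      (measurable_setAverage _).aemeasurable
    have hle : Z.ρ (setAverage E) ≤ Z.ρ (fun t => ⨆ n : ℕ, setAverage (E ∩ Iic (n : ℝ)) t) := by
      refine Z.mono _ _ (measurable_setAverage E).aemeasurable (AEMeasurable.iSup hm)
        (Filter.Eventually.of_forall fun t => ?_)
      obtain ⟨n, hn⟩ := exists_nat_ge t
      refine le_trans (mul_le_mul_right ?_ _)
        (le_iSup (fun n : ℕ => setAverage (E ∩ Iic (n : ℝ)) t) n)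
      refine measure_mono_ae ?_
      filter_upwards [ae_restrict_mem measurableSet_Ioc] with x hx hxE
      exact ⟨hxE, hx.2.trans hn⟩
    rw [Z.fatou _ hm (Filter.Eventually.of_forall fun t m n hmn => mul_le_mul_right
      (measure_mono (inter_subset_inter_right _ (Iic_subset_Iic.2 (by exact_mod_cast hmn)))) _)]
      at hle
    refine hle.trans (iSup_le fun n => (hfin _ ?_).trans
      (mul_le_mul_right (hφ.mass_mono (measure_mono inter_subset_left)) _))
    refine ((measure_mono inter_subset_right).trans_lt ?_).ne
    simp [halfLine_Iic]
  · exact hfin E hE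

/-- The Hardy operator is bounded on `Λ_φ` as soon as it is bounded on characteristic functions. -/
theorem hardyBounded_of_minKernel {φ : ℝ → ℝ} (hφ : QuasiConcave φ) (Z : RISpace) (C : ℝ≥0)
    (h : ∀ t, 0 < t →
      Z.ρ (fun s => ENNReal.ofReal (min 1 (t / s))) ≤ C * ENNReal.ofReal (φ t)) :
    HardyBounded hφ Z := by
  have hnorm : ∀ f ∈ lorentzSpace hφ, Z.norm (hardy f) ≤ (C * 2 : ℝ≥0) * lorentzNorm hφ f := by
    intro f hf
    have hcoe : ∀ k : ℤ, (2 : ℝ≥0∞) ^ k = ((2 ^ k : ℝ≥0) : ℝ≥0∞) := fun k => by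
      rw [ENNReal.coe_zpow (by norm_num)]; rfl
    have hm : ∀ k : ℤ, AEMeasurable
        (fun t => 2 ^ k * setAverage {x | (2 : ℝ≥0∞) ^ k < ‖f x‖ₑ} t) halfLine := fun k =>
      ((measurable_setAverage _).const_mul _).aemeasurable
    calc Z.norm (hardy f)
        ≤ Z.ρ (fun t => ∑' k : ℤ, 2 ^ k * setAverage {x | (2 : ℝ≥0∞) ^ k < ‖f x‖ₑ} t) := by
          refine Z.mono _ _ (hardy_aemeasurable hf.1).enorm (AEMeasurable.tsum hm) ?_
          filter_upwards [ae_halfLine_pos] with t ht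
          exact enorm_hardy_le hf.1 ht
      _ ≤ ∑' k : ℤ, Z.ρ (fun t => 2 ^ k * setAverage {x | (2 : ℝ≥0∞) ^ k < ‖f x‖ₑ} t) :=
          Z.ρ_tsum_le _ hm
      _ ≤ ∑' k : ℤ, C * (2 ^ k * hφ.mass (distribution (fun x => ‖f x‖ₑ) (2 ^ k))) := by
          refine ENNReal.tsum_le_tsum fun k => ?_
          have := Z.smul (2 ^ k) (setAverage {x | (2 : ℝ≥0∞) ^ k < ‖f x‖ₑ})
            (measurable_setAverage _).aemeasurable
          rw [← hcoe] at this
          rw [this, mul_left_comm]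
          exact mul_le_mul_right (ρ_setAverage_le hφ Z C h _) _
      _ ≤ C * (2 * lorentzNorm hφ f) := by
          rw [ENNReal.tsum_mul_left]
          exact mul_le_mul_right (tsum_le_lorentzNorm hφ f) _
      _ = _ := by rw [← mul_assoc]; simp
  exact ⟨C * 2, fun f hf => ⟨⟨hardy_aemeasurable hf.1,
    (hnorm f hf).trans_lt (ENNReal.mul_lt_top ENNReal.coe_lt_top hf.2)⟩, hnorm f hf⟩⟩

/-! ### Characteristic functions of intervals -/

theorem lorentzNorm_indicator_Iio_le {φ : ℝ → ℝ} (hφ : QuasiConcave φ) {a : ℝ} (ha : 0 < a) :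
    lorentzNorm hφ ((Iio a).indicator fun _ => 1) ≤ ENNReal.ofReal (φ a) := by
  have hanti : Antitone ((Iio a).indicator fun _ : ℝ => (1 : ℝ≥0∞)) := fun x y hxy => by
    by_cases hy : y < a
    · simp [hy, hxy.trans_lt hy]
    · simp [hy]
  calc lorentzNorm hφ ((Iio a).indicator fun _ => 1)
      ≤ ∫⁻ t, (Iio a).indicator (fun _ => 1) t ∂hφ.measure :=
        lintegral_mono fun t => rearrangement_le_of_antitone hanti (fun x => by
          by_cases hx : x < a <;> simp [hx]) t
    _ = ENNReal.ofReal (φ a) := by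
        rw [lintegral_indicator_const measurableSet_Iio, hφ.measure_Iio ha, one_mul]

theorem indicator_Iio_mem_lorentzSpace {φ : ℝ → ℝ} (hφ : QuasiConcave φ) {a : ℝ} (ha : 0 < a) :
    ((Iio a).indicator fun _ => 1) ∈ lorentzSpace hφ :=
  ⟨(measurable_const.indicator measurableSet_Iio).aemeasurable,
    (lorentzNorm_indicator_Iio_le hφ ha).trans_lt ENNReal.ofReal_lt_top⟩

theorem hardy_indicator_Iio {a s : ℝ} (ha : 0 < a) (hs : 0 < s) :
    hardy ((Iio a).indicator fun _ => 1) s = min 1 (a / s) := by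
  have hset : (volume.restrict (Ioc 0 s)).real (Iio a) = min s a := by
    rw [measureReal_restrict_apply measurableSet_Iio]
    rcases lt_or_ge s a with h | h
    · have : Iio a ∩ Ioc 0 s = Ioc 0 s :=
        inter_eq_right.2 fun x hx => hx.2.trans_lt h
      rw [this, Real.volume_real_Ioc_of_le hs.le, min_eq_left h.le, sub_zero]
    · have : Iio a ∩ Ioc 0 s = Ioo 0 a := by
        ext x
        simp only [mem_inter_iff, mem_Iio, mem_Ioc, mem_Ioo]
        exact ⟨fun hx => ⟨hx.2.1, hx.1⟩, fun hx => ⟨hx.2, hx.1, hx.2.le.trans h⟩⟩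
      rw [this, Real.volume_real_Ioo_of_le ha.le, min_eq_right h, sub_zero]
  rw [hardy, integral_indicator_const _ measurableSet_Iio, hset, smul_eq_mul, mul_one,
    mul_min_of_nonneg _ _ (by positivity)]
  congr 1
  · field_simp
  · ring

/-- The norm of `min(1, a / s)` is controlled by the Hardy operator. -/
theorem ρ_minKernel_le {φ : ℝ → ℝ} {hφ : QuasiConcave φ} {Z : RISpace} {C : ℝ≥0}
    (hZ : ∀ f ∈ lorentzSpace hφ, Z.norm (hardy f) ≤ C * lorentzNorm hφ f) {a : ℝ} (ha : 0 < a) :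
    Z.ρ (fun s => ENNReal.ofReal (min 1 (a / s))) ≤ C * ENNReal.ofReal (φ a) := by
  have hmem := indicator_Iio_mem_lorentzSpace hφ ha
  refine le_trans ?_ ((hZ _ hmem).trans
    (mul_le_mul_right (lorentzNorm_indicator_Iio_le hφ ha) _))
  refine Z.mono _ _ (measurable_minKernel a).aemeasurable (hardy_aemeasurable hmem.1).enorm ?_
  filter_upwards [ae_halfLine_pos] with s hs
  rw [hardy_indicator_Iio ha hs, Real.enorm_of_nonneg (by positivity)]

theorem ρ_indicator_le {φ : ℝ → ℝ} {hφ : QuasiConcave φ} {Z : RISpace} {C : ℝ≥0}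
    (hZ : ∀ f ∈ lorentzSpace hφ, Z.norm (hardy f) ≤ C * lorentzNorm hφ f) {E : Set ℝ}
    (hE : MeasurableSet E) (hfin : halfLine E < ∞) :
    Z.ρ (E.indicator fun _ => 1) ≤ C * ENNReal.ofReal (φ ((halfLine E).toReal + 1)) := by
  set a := (halfLine E).toReal with ha
  have hdist : ∀ (A : Set ℝ) (l : ℝ≥0∞), distribution (A.indicator fun _ => 1) l =
      if l < 1 then halfLine A else 0 := fun A l => by
    split_ifs with hl
    · rw [distribution]
      congr 1
      ext x
      by_cases hx : x ∈ A <;> simp [hx, hl]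
    · have : {x | l < A.indicator (fun _ => 1) x} = ∅ := by
        ext x
        by_cases hx : x ∈ A <;> simp [hx, not_lt.1 hl]
      rw [distribution, this, measure_empty]
  have hm : ∀ {A : Set ℝ}, MeasurableSet A →
      AEMeasurable (A.indicator fun _ => (1 : ℝ≥0∞)) halfLine := fun hA =>
    (measurable_const.indicator hA).aemeasurable
  rw [Z.rearrangement_invariant _ ((Iio a).indicator fun _ => 1) (hm hE) (hm measurableSet_Iio)
    fun l => by rw [hdist, hdist, halfLine_Iio, ha, ENNReal.ofReal_toReal hfin.ne]]
  have ha0 : 0 ≤ a := ENNReal.toReal_nonneg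
  refine le_trans ?_ (ρ_minKernel_le hZ (a := a + 1) (by positivity))
  refine Z.mono _ _ (hm measurableSet_Iio) (measurable_minKernel _).aemeasurable ?_
  filter_upwards [ae_halfLine_pos] with s hs
  by_cases hsa : s < a
  · rw [indicator_of_mem (by exact hsa), min_eq_left ((one_le_div hs).2 (by linarith)),
      ENNReal.ofReal_one]
  · rw [indicator_of_notMem (by exact hsa)]
    exact zero_le

instance : SFinite halfLine := by unfold halfLine; infer_instance

theorem halfLine_ofReal_lt (y : ℝ≥0∞) : halfLine {t | ENNReal.ofReal t < y} = y := by
  rcases eq_or_ne y ∞ with rfl | hy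
  · simp [halfLine]
  rcases eq_or_ne y 0 with rfl | h0
  · simp
  have h : {t | ENNReal.ofReal t < y} = Iio y.toReal := by
    ext t
    change ENNReal.ofReal t < y ↔ t < y.toReal
    conv_lhs => rw [← ENNReal.ofReal_toReal hy]
    exact ENNReal.ofReal_lt_ofReal_iff (ENNReal.toReal_pos h0 hy)
  rw [h, halfLine_Iio, ENNReal.ofReal_toReal hy]

/-- The layer-cake formula for `[0, ∞]`-valued functions. -/
theorem lintegral_eq_lintegral_distribution {h : ℝ → ℝ≥0∞} (hh : AEMeasurable h halfLine) :
    ∫⁻ x, h x ∂halfLine = ∫⁻ t, distribution h (ENNReal.ofReal t) ∂halfLine := by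
  have hdist : ∀ l, distribution h l = distribution (hh.mk h) l := fun l => by
    refine measure_congr ?_
    filter_upwards [hh.ae_eq_mk] with x hx
    change (l < h x) = (l < hh.mk h x)
    rw [hx]
  simp_rw [hdist]
  rw [lintegral_congr_ae hh.ae_eq_mk]
  have hm : Measurable (hh.mk h) := hh.measurable_mk
  set g := hh.mk h
  have hset : MeasurableSet {p : ℝ × ℝ | ENNReal.ofReal p.2 < g p.1} :=
    measurableSet_lt (ENNReal.measurable_ofReal.comp measurable_snd) (hm.comp measurable_fst)
  have h1 := Measure.prod_apply (μ := halfLine) (ν := halfLine) hset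
  have h2 := Measure.prod_apply_symm (μ := halfLine) (ν := halfLine) hset
  rw [h1] at h2
  refine Eq.trans (lintegral_congr fun x => ?_) h2
  exact (halfLine_ofReal_lt _).symm

theorem aemeasurable_sub_const {f : ℝ → ℝ≥0∞} (hf : AEMeasurable f halfLine) (l : ℝ≥0∞) :
    AEMeasurable (fun x => f x - l) halfLine := hf.sub aemeasurable_const

/-- The functional `inf_λ (λ + ∫ (f - λ)₊)`, which equals `∫_0^1 f^*`. -/
noncomputable def sumNorm (f : ℝ → ℝ≥0∞) : ℝ≥0∞ :=
  ⨅ l : ℝ≥0, ((l : ℝ≥0∞) + ∫⁻ x, (f x - l) ∂halfLine)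

theorem sumNorm_le (f : ℝ → ℝ≥0∞) (l : ℝ≥0) :
    sumNorm f ≤ l + ∫⁻ x, (f x - l) ∂halfLine := iInf_le _ l

theorem sumNorm_mono {f g : ℝ → ℝ≥0∞} (h : ∀ᵐ x ∂halfLine, f x ≤ g x) :
    sumNorm f ≤ sumNorm g :=
  iInf_mono fun _ => add_le_add le_rfl
    (lintegral_mono_ae (h.mono fun _ hx => tsub_le_tsub_right hx _))

theorem setLIntegral_le_sumNorm {f : ℝ → ℝ≥0∞} (E : Set ℝ) (hE : halfLine E ≠ ∞) :
    ∫⁻ x in E, f x ∂halfLine ≤ max (halfLine E) 1 * sumNorm f := by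
  rw [sumNorm, ENNReal.mul_iInf_of_ne (by simp) (by simp [hE])]
  refine le_iInf fun l => ?_
  calc ∫⁻ x in E, f x ∂halfLine ≤ ∫⁻ x in E, (l + (f x - l)) ∂halfLine :=
        lintegral_mono fun x => le_add_tsub
    _ = l * halfLine E + ∫⁻ x in E, (f x - l) ∂halfLine := by
        rw [lintegral_add_left measurable_const, setLIntegral_const]
    _ ≤ max (halfLine E) 1 * l + max (halfLine E) 1 * ∫⁻ x, (f x - l) ∂halfLine := by
        rw [mul_comm (l : ℝ≥0∞)]
        refine add_le_add (mul_le_mul_left (le_max_left _ _) _) ?_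
        exact (setLIntegral_le_lintegral _ _).trans (le_mul_of_one_le_left' (le_max_right _ _))
    _ = _ := (mul_add _ _ _).symm

theorem sumNorm_eq_zero_iff {f : ℝ → ℝ≥0∞} (hf : AEMeasurable f halfLine) :
    sumNorm f = 0 ↔ f =ᵐ[halfLine] 0 := by
  constructor
  · intro h
    have hU : (⋃ n : ℕ, Iic (n : ℝ)) = univ := by
      ext x
      simpa using exists_nat_ge x
    rw [Filter.EventuallyEq, ← Measure.restrict_univ (μ := halfLine), ← hU,
      ae_restrict_iUnion_iff]
    intro n
    have := setLIntegral_le_sumNorm (f := f) (Iic (n : ℝ)) (by simp [halfLine_Iic])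
    rw [h, mul_zero, nonpos_iff_eq_zero, lintegral_eq_zero_iff' hf.restrict] at this
    exact this
  · intro h
    refine le_antisymm ((sumNorm_le f 0).trans ?_) zero_le
    simp [lintegral_congr_ae h]

theorem sumNorm_smul_le {f : ℝ → ℝ≥0∞} {a : ℝ≥0} (ha : a ≠ 0) :
    sumNorm (fun x => a * f x) ≤ a * sumNorm f := by
  rw [sumNorm, sumNorm, ENNReal.mul_iInf_of_ne (by simpa using ha) (by simp)]
  refine le_iInf fun l => (iInf_le _ (a * l)).trans_eq ?_
  rw [mul_add, ← lintegral_const_mul' _ _ ENNReal.coe_ne_top, ENNReal.coe_mul]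
  simp_rw [ENNReal.mul_sub (fun _ _ => ENNReal.coe_ne_top)]

theorem sumNorm_smul (a : ℝ≥0) {f : ℝ → ℝ≥0∞} (hf : AEMeasurable f halfLine) :
    sumNorm (fun x => a * f x) = a * sumNorm f := by
  rcases eq_or_ne a 0 with rfl | ha
  · rw [(sumNorm_eq_zero_iff (hf.const_mul _)).2 (Filter.Eventually.of_forall fun x => by simp)]
    simp
  refine le_antisymm (sumNorm_smul_le ha) ?_
  have h := sumNorm_smul_le (f := fun x => a * f x) (inv_ne_zero ha)
  have hinv : (a : ℝ≥0∞) * (a⁻¹ : ℝ≥0) = 1 := by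
    rw [← ENNReal.coe_mul, mul_inv_cancel₀ ha, ENNReal.coe_one]
  have hfun : (fun x => ((a⁻¹ : ℝ≥0) : ℝ≥0∞) * (a * f x)) = f := by
    ext x
    rw [← mul_assoc, mul_comm _ (a : ℝ≥0∞), hinv, one_mul]
  rw [hfun] at h
  calc a * sumNorm f ≤ a * ((a⁻¹ : ℝ≥0) * sumNorm fun x => a * f x) := mul_le_mul_right h _
    _ = _ := by rw [← mul_assoc, hinv, one_mul]

theorem sumNorm_add_le {f g : ℝ → ℝ≥0∞} (hf : AEMeasurable f halfLine) :
    sumNorm (fun x => f x + g x) ≤ sumNorm f + sumNorm g := by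
  simp_rw [sumNorm, ENNReal.iInf_add, ENNReal.add_iInf]
  refine le_iInf fun l => le_iInf fun m => (iInf_le _ (l + m)).trans ?_
  rw [add_add_add_comm, ← lintegral_add_left' (aemeasurable_sub_const hf _), ENNReal.coe_add]
  exact add_le_add le_rfl (lintegral_mono fun x => add_tsub_add_le_tsub_add_tsub)

theorem sumNorm_congr_distribution {f g : ℝ → ℝ≥0∞} (hf : AEMeasurable f halfLine)
    (hg : AEMeasurable g halfLine) (h : ∀ l, distribution f l = distribution g l) :
    sumNorm f = sumNorm g := by
  refine iInf_congr fun l => ?_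
  rw [lintegral_eq_lintegral_distribution (aemeasurable_sub_const hf _),
    lintegral_eq_lintegral_distribution (aemeasurable_sub_const hg _)]
  congr 1
  refine lintegral_congr fun t => ?_
  have := h (l + ENNReal.ofReal t)
  simpa only [distribution, lt_tsub_iff_left] using this

theorem sumNorm_iSup (f : ℕ → ℝ → ℝ≥0∞) (hf : ∀ n, AEMeasurable (f n) halfLine)
    (hmono : ∀ᵐ x ∂halfLine, Monotone fun n => f n x) :
    sumNorm (fun x => ⨆ n, f n x) = ⨆ n, sumNorm (f n) := by
  refine le_antisymm ?_ (iSup_le fun n => sumNorm_mono (Filter.Eventually.of_forall fun x =>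
    le_iSup (fun n => f n x) n))
  refine ENNReal.le_of_forall_pos_le_add fun δ hδ hL => ?_
  set L := ⨆ n, sumNorm (f n) with hLdef
  set ε : ℝ≥0 := δ / 3 with hε
  have hε0 : 0 < ε := by positivity
  have hex : ∀ n, ∃ l : ℝ≥0, (l : ℝ≥0∞) + ∫⁻ x, (f n x - l) ∂halfLine < L + ε := fun n => by
    refine iInf_lt_iff.1 ((le_iSup (fun n => sumNorm (f n)) n).trans_lt ?_)
    exact ENNReal.lt_add_right hL.ne (by simpa using hε0.ne')
  choose l hl using hex
  have hbound : ∀ n, (l n : ℝ) ∈ Icc (0 : ℝ) (L + ε).toReal := fun n => by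
    refine ⟨(l n).coe_nonneg, ?_⟩
    have := (le_self_add.trans (hl n).le : (l n : ℝ≥0∞) ≤ L + ε)
    simpa using ENNReal.toReal_mono (by simp [hL.ne]) this
  obtain ⟨μ, hμ, σ, hσ, hlim⟩ := isCompact_Icc.tendsto_subseq hbound
  set m : ℝ≥0 := μ.toNNReal + ε with hm
  have hmr : (m : ℝ) = μ + ε := by simp [hm, hμ.1]
  have hev : ∀ᶠ k in Filter.atTop, l (σ k) ≤ m ∧ m ≤ l (σ k) + 2 * ε := by
    have h1 := hlim.eventually_lt_const (show μ < μ + ε by simpa using hε0)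
    have h2 := hlim.eventually_const_lt (show μ - ε < μ by simpa using hε0)
    filter_upwards [h1, h2] with k hk1 hk2
    simp only [Function.comp] at hk1 hk2
    rw [← NNReal.coe_le_coe, ← NNReal.coe_le_coe, hmr]
    push_cast
    constructor <;> linarith
  have hbig : ∀ n, (m : ℝ≥0∞) + ∫⁻ x, (f n x - m) ∂halfLine ≤ L + δ := fun n => by
    obtain ⟨k, ⟨hk1, hk2⟩, hkn⟩ := (hev.and (Filter.eventually_ge_atTop n)).exists
    calc (m : ℝ≥0∞) + ∫⁻ x, (f n x - m) ∂halfLine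
        ≤ (l (σ k) + 2 * ε : ℝ≥0) + ∫⁻ x, (f (σ k) x - l (σ k)) ∂halfLine := by
          refine add_le_add (by exact_mod_cast hk2) (lintegral_mono_ae ?_)
          filter_upwards [hmono] with x hx
          exact tsub_le_tsub (hx (hkn.trans (hσ.id_le k))) (by exact_mod_cast hk1)
      _ = ((l (σ k) : ℝ≥0∞) + ∫⁻ x, (f (σ k) x - l (σ k)) ∂halfLine) + (2 * ε : ℝ≥0) := by
          rw [ENNReal.coe_add]; ring
      _ ≤ (L + ε) + (2 * ε : ℝ≥0) := add_le_add (hl _).le le_rfl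
      _ = L + δ := by
          rw [add_assoc, ← ENNReal.coe_add]
          congr 2
          rw [hε]
          field_simp
          norm_num
  refine (sumNorm_le _ m).trans ?_
  simp_rw [ENNReal.iSup_sub]
  rw [lintegral_iSup' (fun n => aemeasurable_sub_const (hf n) _)
    (hmono.mono fun x hx i j hij => tsub_le_tsub_right (hx hij) _), ENNReal.add_iSup]
  exact iSup_le hbig

/-- The space `L¹ + L^∞`. -/
noncomputable def sumSpace : RISpace where
  ρ := sumNorm
  eq_zero_iff _ hf := sumNorm_eq_zero_iff hf
  smul a _ hf := sumNorm_smul a hf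
  add_le _ _ hf _ := sumNorm_add_le hf
  mono _ _ _ _ h := sumNorm_mono h
  fatou := sumNorm_iSup
  indicator_lt_top E hE hfin := by
    refine (sumNorm_le _ 0).trans_lt ?_
    simpa [lintegral_indicator_const hE] using hfin
  setLIntegral_le E hE hfin := by
    refine ⟨(max (halfLine E) 1).toNNReal, fun f _ => ?_⟩
    rw [ENNReal.coe_toNNReal (by simp [hfin.ne])]
    exact setLIntegral_le_sumNorm E hfin.ne
  rearrangement_invariant _ _ := sumNorm_congr_distribution

theorem sumNorm_minKernel_le_one (t : ℝ) :
    sumNorm (fun s => ENNReal.ofReal (min 1 (t / s))) ≤ 1 := by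
  refine (sumNorm_le _ 1).trans ?_
  have : ∀ s : ℝ, ENNReal.ofReal (min 1 (t / s)) - ((1 : ℝ≥0) : ℝ≥0∞) = 0 := fun s => by
    rw [tsub_eq_zero_iff_le, ENNReal.coe_one, ← ENNReal.ofReal_one]
    exact ENNReal.ofReal_le_ofReal (min_le_left _ _)
  simp_rw [this]
  simp

theorem setLIntegral_Ioc_div {t : ℝ} (ht : 0 < t) (ht1 : t ≤ 1) :
    ∫⁻ s in Ioc t 1, ENNReal.ofReal (t / s) = ENNReal.ofReal (t * Real.log (1 / t)) := by
  have hint : IntervalIntegrable (fun s : ℝ => t / s) volume t 1 := by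
    refine ContinuousOn.intervalIntegrable fun s hs => ?_
    rw [uIcc_of_le ht1] at hs
    exact (continuousAt_const.div continuousAt_id (ht.trans_le hs.1).ne').continuousWithinAt
  rw [← ofReal_integral_eq_lintegral_ofReal]
  · rw [← intervalIntegral.integral_of_le ht1]
    simp_rw [div_eq_mul_inv t]
    rw [intervalIntegral.integral_const_mul, integral_inv_of_pos ht one_pos]
  · exact (intervalIntegrable_iff_integrableOn_Ioc_of_le ht1).1 hint
  · filter_upwards [ae_restrict_mem measurableSet_Ioc] with s hs
    have := ht.trans hs.1
    simp only [Pi.zero_apply]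
    positivity

theorem sumNorm_minKernel_le {t : ℝ} (ht : 0 < t) (ht1 : t ≤ 1) :
    sumNorm (fun s => ENNReal.ofReal (min 1 (t / s))) ≤
      ENNReal.ofReal (2 * t + t * Real.log (1 / t)) := by
  have hlog : 0 ≤ Real.log (1 / t) := Real.log_nonneg ((one_le_div ht).2 ht1)
  calc sumNorm (fun s => ENNReal.ofReal (min 1 (t / s)))
      ≤ ENNReal.ofReal t +
          ∫⁻ s, (ENNReal.ofReal (min 1 (t / s)) - ENNReal.ofReal t) ∂halfLine :=
        sumNorm_le _ t.toNNReal
    _ ≤ ENNReal.ofReal t + ∫⁻ s, ((Iic t).indicator (fun _ => 1) s +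
          (Ioc t 1).indicator (fun s => ENNReal.ofReal (t / s)) s) ∂halfLine := by
        refine add_le_add le_rfl (lintegral_mono_ae ?_)
        filter_upwards [ae_halfLine_pos] with s hs
        rcases le_or_gt s t with hst | hst
        · rw [indicator_of_mem (by exact hst)]
          refine tsub_le_self.trans (le_add_right ?_)
          rw [← ENNReal.ofReal_one]
          exact ENNReal.ofReal_le_ofReal (min_le_left _ _)
        rcases le_or_gt s 1 with hs1 | hs1
        · rw [indicator_of_mem (s := Ioc t 1) ⟨hst, hs1⟩]
          exact tsub_le_self.trans
            (le_add_left (ENNReal.ofReal_le_ofReal (min_le_right _ _)))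
        · rw [tsub_eq_zero_of_le]
          · exact zero_le
          · refine ENNReal.ofReal_le_ofReal ((min_le_right _ _).trans ?_)
            exact div_le_self ht.le hs1.le
    _ = ENNReal.ofReal t + (ENNReal.ofReal t + ENNReal.ofReal (t * Real.log (1 / t))) := by
        rw [lintegral_add_left (measurable_const.indicator measurableSet_Iic),
          lintegral_indicator_const measurableSet_Iic, halfLine_Iic, one_mul,
          lintegral_indicator measurableSet_Ioc, halfLine,
          Measure.restrict_restrict measurableSet_Ioc,
          inter_eq_left.2 (show Ioc t 1 ⊆ Ioi 0 from fun s hs => ht.trans hs.1),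
          setLIntegral_Ioc_div ht ht1]
    _ = _ := by
        rw [← ENNReal.ofReal_add ht.le (by positivity), ← ENNReal.ofReal_add ht.le (by positivity)]
        congr 1
        ring

theorem hardyBounded_sumSpace {φ : ℝ → ℝ} (hφ : QuasiConcave φ)
    (h : ∃ C : ℝ, 0 < C ∧ ∀ t : ℝ, 0 < t → C * t * Real.log (1 + 1 / t) ≤ φ t) :
    HardyBounded hφ sumSpace := by
  obtain ⟨C, hC, hlow⟩ := h
  have hlog2 : (1 / 2 : ℝ) ≤ Real.log 2 := by linarith [Real.log_two_gt_d9]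
  refine hardyBounded_of_minKernel hφ sumSpace (5 / C).toNNReal fun t ht => ?_
  change sumNorm _ ≤ ENNReal.ofReal (5 / C) * _
  rw [← ENNReal.ofReal_mul (by positivity)]
  rcases le_total t 1 with ht1 | ht1
  · refine (sumNorm_minKernel_le ht ht1).trans (ENNReal.ofReal_le_ofReal ?_)
    have h1 : Real.log (1 / t) ≤ Real.log (1 + 1 / t) :=
      Real.log_le_log (by positivity) (by linarith)
    have h2 : Real.log 2 ≤ Real.log (1 + 1 / t) :=
      Real.log_le_log (by norm_num) (by linarith [(one_le_div ht).2 ht1])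
    calc 2 * t + t * Real.log (1 / t) = t * (2 + Real.log (1 / t)) := by ring
      _ ≤ t * (5 * Real.log (1 + 1 / t)) := by gcongr; linarith
      _ = 5 / C * (C * t * Real.log (1 + 1 / t)) := by field_simp
      _ ≤ _ := by gcongr; exact hlow t ht
  · refine (sumNorm_minKernel_le_one t).trans ?_
    rw [← ENNReal.ofReal_one]
    refine ENNReal.ofReal_le_ofReal ?_
    have h1 : C * Real.log 2 ≤ φ t := by
      refine le_trans ?_ ((hlow 1 one_pos).trans (hφ.mono 1 t one_pos ht1))
      norm_num
    calc (1 : ℝ) ≤ 5 * Real.log 2 := by linarith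
      _ = 5 / C * (C * Real.log 2) := by field_simp
      _ ≤ _ := by gcongr

/-! ### The optimal range -/

theorem exists_isOptimalRange {φ : ℝ → ℝ} (hφ : QuasiConcave φ) {Z₀ : RISpace}
    (h₀ : HardyBounded hφ Z₀) : ∃ N : RISpace, IsOptimalRange hφ N := by
  have hscale : ∀ Z : RISpace, HardyBounded hφ Z → ∃ (c : ℝ≥0) (hc : c ≠ 0),
      ∀ f ∈ lorentzSpace hφ, (Z.scale c hc).norm (hardy f) ≤ (1 : ℝ≥0) * lorentzNorm hφ f := by
    rintro Z ⟨C, hC⟩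
    refine ⟨(C + 1)⁻¹, by positivity, fun f hf => ?_⟩
    change ((C + 1)⁻¹ : ℝ≥0) * Z.norm (hardy f) ≤ _
    calc (((C + 1)⁻¹ : ℝ≥0) : ℝ≥0∞) * Z.norm (hardy f)
        ≤ ((C + 1)⁻¹ : ℝ≥0) * (C * lorentzNorm hφ f) := mul_le_mul_right (hC f hf).2 _
      _ = ((C + 1)⁻¹ * C : ℝ≥0) * lorentzNorm hφ f := by rw [← mul_assoc, ENNReal.coe_mul]
      _ ≤ (1 : ℝ≥0) * lorentzNorm hφ f := by
          gcongr
          rw [inv_mul_le_iff₀ (by positivity)]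
          simp
  let ι := {Z : RISpace //
    ∀ f ∈ lorentzSpace hφ, Z.norm (hardy f) ≤ (1 : ℝ≥0) * lorentzNorm hφ f}
  obtain ⟨c₀, hc₀, hZ₀⟩ := hscale Z₀ h₀
  let N : RISpace := RISpace.sup (ι := ι) ⟨_, hZ₀⟩ (fun Z => Z.1) fun E hE hfin =>
    (iSup_le fun Z => ρ_indicator_le Z.2 hE hfin).trans_lt
      (ENNReal.mul_lt_top ENNReal.coe_lt_top ENNReal.ofReal_lt_top)
  have hN : ∀ f ∈ lorentzSpace hφ, N.norm (hardy f) ≤ (1 : ℝ≥0) * lorentzNorm hφ f :=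
    fun f hf => iSup_le fun Z : ι => Z.2 f hf
  refine ⟨N, ⟨1, fun f hf => ⟨⟨hardy_aemeasurable hf.1, (hN f hf).trans_lt
    (ENNReal.mul_lt_top ENNReal.coe_lt_top hf.2)⟩, hN f hf⟩⟩, fun Z hZ f hf => ⟨hf.1, ?_⟩⟩
  obtain ⟨c, hc, hcZ⟩ := hscale Z hZ
  have hle : (c : ℝ≥0∞) * Z.norm f ≤ N.norm f :=
    le_iSup (fun i : ι => i.1.ρ fun x => ‖f x‖ₑ) ⟨Z.scale c hc, hcZ⟩
  by_contra htop
  rw [not_lt, top_le_iff] at htop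
  rw [htop, ENNReal.mul_top (by simpa using hc), top_le_iff] at hle
  exact hf.2.ne hle

/-! ### The equation `R(X) = Λ_φ` -/

theorem kernel_enorm_le_minKernel {t s : ℝ} (ht : 0 < t) (hs : 0 < s) :
    ‖1 / (1 + s / t)‖ₑ ≤ ENNReal.ofReal (min 1 (t / s)) := by
  rw [Real.enorm_of_nonneg (by positivity)]
  refine ENNReal.ofReal_le_ofReal (le_min ?_ ?_)
  · rw [div_le_one (by positivity)]
    linarith [div_pos hs ht]
  · rw [div_le_div_iff₀ (by positivity) hs, mul_add, mul_div_cancel₀ _ ht.ne']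
    linarith

theorem minKernel_le_kernel_enorm {t s : ℝ} (ht : 0 < t) (hs : 0 < s) :
    ENNReal.ofReal (min 1 (t / s)) ≤ (2 : ℝ≥0) * ‖1 / (1 + s / t)‖ₑ := by
  rw [Real.enorm_of_nonneg (by positivity), ← ENNReal.ofReal_coe_nnreal,
    ← ENNReal.ofReal_mul (by positivity)]
  refine ENNReal.ofReal_le_ofReal ?_
  rw [NNReal.coe_ofNat, mul_one_div, le_div_iff₀ (by positivity), mul_add, mul_one]
  have h1 : min 1 (t / s) ≤ 1 := min_le_left _ _
  have h2 : min 1 (t / s) * (s / t) ≤ 1 := by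
    calc min 1 (t / s) * (s / t) ≤ t / s * (s / t) := by
          gcongr
          exact min_le_right _ _
      _ = 1 := by field_simp
  linarith

theorem RISpace.ofReal_W (X : RISpace) (hX : (fun s : ℝ => 1 / (1 + s)) ∈ X.carrier) {t : ℝ}
    (ht : 0 < t) : ENNReal.ofReal (X.W t) = X.norm (fun s => 1 / (1 + s / t)) :=
  ENNReal.ofReal_toReal (X.norm_kernel_lt_top hX ht).ne

/-- The Hardy operator is bounded from `Λ_φ` to `X` whenever `Λ_φ ⊆ R(X)`. -/
theorem RISpace.hardyBounded_of_subset_R {φ : ℝ → ℝ} (hφ : QuasiConcave φ) (X : RISpace)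
    (hX : (fun s : ℝ => 1 / (1 + s)) ∈ X.carrier) (h : lorentzSpace hφ ⊆ X.R hX) :
    HardyBounded hφ X := by
  obtain ⟨C, hC⟩ := exists_le_of_lorentzSpace_subset hφ (X.quasiConcave_W hX) h
  refine hardyBounded_of_minKernel hφ X (2 * C) fun t ht => ?_
  have hm : AEMeasurable (fun s : ℝ => ‖1 / (1 + s / t)‖ₑ) halfLine :=
    (measurable_kernel t).enorm.aemeasurable
  calc X.ρ (fun s => ENNReal.ofReal (min 1 (t / s)))
      ≤ X.ρ (fun s => (2 : ℝ≥0) * ‖1 / (1 + s / t)‖ₑ) := by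
        refine X.mono _ _ (measurable_minKernel t).aemeasurable (hm.const_mul _) ?_
        filter_upwards [ae_halfLine_pos] with s hs
        exact minKernel_le_kernel_enorm ht hs
    _ = (2 : ℝ≥0) * ENNReal.ofReal (X.W t) := by rw [X.smul _ _ hm, X.ofReal_W hX ht]; rfl
    _ ≤ (2 : ℝ≥0) * (C * ENNReal.ofReal (φ t)) := by
        refine mul_le_mul_right ?_ _
        rw [← ENNReal.ofReal_coe_nnreal, ← ENNReal.ofReal_mul C.coe_nonneg]
        exact ENNReal.ofReal_le_ofReal (hC t ht)
    _ = _ := by rw [ENNReal.coe_mul, mul_assoc]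

/-- If the equation `R(X) = Λ_φ` is solvable, then the optimal range is a solution. -/
theorem IsOptimalRange.solves {φ : ℝ → ℝ} {hφ : QuasiConcave φ} {N X : RISpace}
    (hN : IsOptimalRange hφ N) (hX : X.Solves hφ) : N.Solves hφ := by
  obtain ⟨hXk, hXR⟩ := hX
  obtain ⟨⟨A, hA⟩, hmin⟩ := hN
  have hker : ∀ t : ℝ, 0 < t →
      N.norm (fun s => 1 / (1 + s / t)) ≤ A * ENNReal.ofReal (φ t) := fun t ht => by
    refine le_trans ?_ (ρ_minKernel_le (fun f hf => (hA f hf).2) ht)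
    refine N.mono _ _ (RISpace.measurable_kernel t).enorm.aemeasurable
      (measurable_minKernel t).aemeasurable ?_
    filter_upwards [ae_halfLine_pos] with s hs
    exact kernel_enorm_le_minKernel ht hs
  have hNk : (fun s : ℝ => 1 / (1 + s)) ∈ N.carrier := by
    refine ⟨by fun_prop, ?_⟩
    have := (hker 1 one_pos).trans_lt (ENNReal.mul_lt_top ENNReal.coe_lt_top ENNReal.ofReal_lt_top)
    simpa using this
  have hNφ : ∀ t, 0 < t → N.W t ≤ A * φ t := fun t ht => by
    have h1 := hker t ht
    rw [← N.ofReal_W hNk ht, ← ENNReal.ofReal_coe_nnreal,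
      ← ENNReal.ofReal_mul A.coe_nonneg] at h1
    exact (ENNReal.ofReal_le_ofReal_iff (mul_nonneg A.coe_nonneg (hφ.pos t ht).le)).1 h1
  obtain ⟨B, hB⟩ := RISpace.exists_ρ_le_of_subset
    (hmin X (X.hardyBounded_of_subset_R hφ hXk hXR.ge))
  have hXN : ∀ t, 0 < t → X.W t ≤ B * N.W t := fun t ht => by
    have h1 : X.norm (fun s => 1 / (1 + s / t)) ≤ B * N.norm (fun s => 1 / (1 + s / t)) :=
      hB _ (RISpace.measurable_kernel t).enorm.aemeasurable
    rw [← N.ofReal_W hNk ht, ← X.ofReal_W hXk ht, ← ENNReal.ofReal_coe_nnreal,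
      ← ENNReal.ofReal_mul B.coe_nonneg] at h1
    exact (ENNReal.ofReal_le_ofReal_iff
      (mul_nonneg B.coe_nonneg ((N.quasiConcave_W hNk).pos t ht).le)).1 h1
  obtain ⟨D, hD⟩ := exists_le_of_lorentzSpace_subset (X.quasiConcave_W hXk) hφ hXR.le
  refine ⟨hNk, Subset.antisymm ?_ ?_⟩
  · refine lorentzSpace_subset_of_le (N.quasiConcave_W hNk) hφ (D * B) fun t ht => ?_
    calc φ t ≤ D * X.W t := hD t ht
      _ ≤ D * (B * N.W t) := by gcongr; exact hXN t ht
      _ = _ := by push_cast; ring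
  · exact lorentzSpace_subset_of_le hφ (N.quasiConcave_W hNk) A hNφ

end RestrictedType

theorem corollary2p4 (φ : ℝ → ℝ) (hφ : RestrictedType.QuasiConcave φ)
    (h3 : ∃ C : ℝ, 0 < C ∧ ∀ t : ℝ, 0 < t → C * t * Real.log (1 + 1 / t) ≤ φ t) :
    (∃ N : RestrictedType.RISpace, RestrictedType.IsOptimalRange hφ N) ∧
    ∀ N : RestrictedType.RISpace, RestrictedType.IsOptimalRange hφ N →
      ((∃ X : RestrictedType.RISpace, X.Solves hφ) ↔ N.Solves hφ) :=
  ⟨RestrictedType.exists_isOptimalRange hφ (RestrictedType.hardyBounded_sumSpace hφ h3),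
    fun N hN => ⟨fun ⟨_, hX⟩ => hN.solves hX, fun h => ⟨N, h⟩⟩⟩
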